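/- Let $A,B,C,D$ be finite-dimensional complex Hilbert spaces with $A,B\neq 0$, and let $U:A\otimes B\to C\otimes D$ be unitary. Write $\mathcal L(H)$ for the algebra of linear operators on $H$, $\mathcal U(X)=UXU^\dagger$ for the unitary channel of $U$, $\mathrm{Tr}_A:\mathcal L(A\otimes B)\to\mathcal L(B)$ and $\mathrm{Tr}_C:\mathcal L(C\otimes D)\to\mathcal L(D)$ for the partial traces, and call a completely positive trace-preserving linear map $\mathcal L(H)\to\mathcal L(K)$ a channel from $H$ to $K$. Then the following six conditions are equivalent. (U1) There is a channel $\Psi$ from $B$ to $D$ such that $\mathrm{Tr}_C\circ\,\mathcal U=\Psi\circ\mathrm{Tr}_A$. (U2) For every channel $\Phi$ from $A$ to $A$, $\mathrm{Tr}_C\circ\,\mathcal U\circ(\Phi\otimes\mathrm{id}_{\mathcal L(B)})=\mathrm{Tr}_C\circ\,\mathcal U$. (U3) For all density operators $\rho,\rho'$ on $A$ and $\sigma$ on $B$, $\mathrm{Tr}_C\,\mathcal U(\rho\otimes\sigma)=\mathrm{Tr}_C\,\mathcal U(\rho'\otimes\sigma)$. (U4) There are a finite-dimensional Hilbert space $X$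 and unitaries $V:B\to X\otimes D$ and $W:A\otimes X\to C$ such that $U=(W\otimes I_D)(I_A\otimes V)$. (U5) For every unitary $V$ on $A$ there is a unitary $V'$ on $C$ such that $U(V\otimes I_B)U^\dagger=V'\otimes I_D$. (U6) $[\,U(\mathcal L(A)\otimes I_B)U^\dagger,\ I_C\otimes\mathcal L(D)\,]=0$, i.e. $U(X\otimes I_B)U^\dagger$ commutes with $I_C\otimes Y$ for all $X\in\mathcal L(A)$ and $Y\in\mathcal L(D)$. -/

import Mathlib

open scoped TensorProduct

namespace NoInfluence

noncomputable section

section Operators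

variable {A B C D : Type*}
  [NormedAddCommGroup A] [InnerProductSpace ℂ A] [FiniteDimensional ℂ A]
  [NormedAddCommGroup B] [InnerProductSpace ℂ B] [FiniteDimensional ℂ B]
  [NormedAddCommGroup C] [InnerProductSpace ℂ C] [FiniteDimensional ℂ C]
  [NormedAddCommGroup D] [InnerProductSpace ℂ D] [FiniteDimensional ℂ D]

/-- The algebra `𝓛(A)` of all linear operators on the finite-dimensional Hilbert space `A`. -/
abbrev Op (A : Type*) [NormedAddCommGroup A] [InnerProductSpace ℂ A] : Type _ := A →ₗ[ℂ] A

/-- A density operator: positive semidefinite with trace one. -/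
def IsState (ρ : Op A) : Prop := ρ.IsPositive ∧ LinearMap.trace ℂ A ρ = 1

/-- The tensor product `Φ ⊗ Ψ : 𝓛(A ⊗ B) → 𝓛(C ⊗ D)` of two linear maps `Φ : 𝓛(A) → 𝓛(C)` and
`Ψ : 𝓛(B) → 𝓛(D)`, obtained from the identification `𝓛(A) ⊗ 𝓛(B) = 𝓛(A ⊗ B)`; see
`tensorSuper_map` for its action on product operators, which determines it. -/
def tensorSuper (Φ : Op A →ₗ[ℂ] Op C) (Ψ : Op B →ₗ[ℂ] Op D) : Op (A ⊗[ℂ] B) →ₗ[ℂ] Op (C ⊗[ℂ] D) :=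
  (homTensorHomEquiv ℂ C D C D).toLinearMap ∘ₗ TensorProduct.map Φ Ψ ∘ₗ
    (homTensorHomEquiv ℂ A B A B).symm.toLinearMap

theorem tensorSuper_map (Φ : Op A →ₗ[ℂ] Op C) (Ψ : Op B →ₗ[ℂ] Op D) (X : Op A) (Y : Op B) :
    tensorSuper Φ Ψ (TensorProduct.map X Y) = TensorProduct.map (Φ X) (Ψ Y) := by
  have h : (homTensorHomEquiv ℂ A B A B).symm (TensorProduct.map X Y) = X ⊗ₜ[ℂ] Y := by
    rw [LinearEquiv.symm_apply_eq]
    simp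
  simp [tensorSuper, h]

/-- The partial trace `Tr_A : 𝓛(A ⊗ B) → 𝓛(B)` over the first factor; it is determined by
`traceOutFst_map`. -/
def traceOutFst (A B : Type*)
    [NormedAddCommGroup A] [InnerProductSpace ℂ A] [FiniteDimensional ℂ A]
    [NormedAddCommGroup B] [InnerProductSpace ℂ B] [FiniteDimensional ℂ B] :
    Op (A ⊗[ℂ] B) →ₗ[ℂ] Op B :=
  (TensorProduct.lid ℂ (Op B)).toLinearMap ∘ₗ
    TensorProduct.map (LinearMap.trace ℂ A) LinearMap.id ∘ₗ
      (homTensorHomEquiv ℂ A B A B).symm.toLinearMap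

theorem traceOutFst_map (X : Op A) (Y : Op B) :
    traceOutFst A B (TensorProduct.map X Y) = LinearMap.trace ℂ A X • Y := by
  have h : (homTensorHomEquiv ℂ A B A B).symm (TensorProduct.map X Y) = X ⊗ₜ[ℂ] Y := by
    rw [LinearEquiv.symm_apply_eq]
    simp
  simp [traceOutFst, h]

/-- Complete positivity: for an ancilla of any finite dimension `n`, the map `I ⊗ Φ` sends positive
semidefinite operators to positive semidefinite operators. -/
def IsCompletelyPositive (Φ : Op A →ₗ[ℂ] Op B) : Prop :=
  ∀ (n : ℕ) (X : Op (EuclideanSpace ℂ (Fin n) ⊗[ℂ] A)), X.IsPositive →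
    (tensorSuper (LinearMap.id : Op (EuclideanSpace ℂ (Fin n)) →ₗ[ℂ] _) Φ X).IsPositive

/-- A quantum channel from `A` to `B`: a completely positive trace-preserving linear map
`𝓛(A) → 𝓛(B)`. -/
def IsChannel (Φ : Op A →ₗ[ℂ] Op B) : Prop :=
  IsCompletelyPositive Φ ∧ ∀ X : Op A, LinearMap.trace ℂ B (Φ X) = LinearMap.trace ℂ A X

/-- The unitary channel `𝓤 = U (·) U†` of a unitary `U : A → B`. -/
def unitaryChannel (U : A ≃ₗᵢ[ℂ] B) : Op A →ₗ[ℂ] Op B :=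
  U.toLinearEquiv.conj.toLinearMap

theorem unitaryChannel_apply (U : A ≃ₗᵢ[ℂ] B) (X : Op A) :
    unitaryChannel U X = U.toLinearMap ∘ₗ X ∘ₗ LinearMap.adjoint U.toLinearMap := by
  have h : LinearMap.adjoint U.toLinearMap = U.symm.toLinearMap := by
    symm
    rw [LinearMap.eq_adjoint_iff]
    intro x y
    exact U.symm.inner_map_eq_flip x y
  rw [h]
  rfl

end Operators

section Conditions

variable {A B C D : Type*}
  [NormedAddCommGroup A] [InnerProductSpace ℂ A] [FiniteDimensional ℂ A]
  [NormedAddCommGroup B] [InnerProductSpace ℂ B] [FiniteDimensional ℂ B]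
  [NormedAddCommGroup C] [InnerProductSpace ℂ C] [FiniteDimensional ℂ C]
  [NormedAddCommGroup D] [InnerProductSpace ℂ D] [FiniteDimensional ℂ D]

/-- Applying `U` and tracing out `C` is the same as tracing out `A` and then applying some channel
from `B` to `D`. -/
def U1 (U : A ⊗[ℂ] B ≃ₗᵢ[ℂ] C ⊗[ℂ] D) : Prop :=
  ∃ Ψ : Op B →ₗ[ℂ] Op D, IsChannel Ψ ∧
    traceOutFst C D ∘ₗ unitaryChannel U = Ψ ∘ₗ traceOutFst A B

/-- The channel obtained by applying `U` and tracing out `C` does not change when a local channel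
`Φ` is first applied to `A`. -/
def U2 (U : A ⊗[ℂ] B ≃ₗᵢ[ℂ] C ⊗[ℂ] D) : Prop :=
  ∀ Φ : Op A →ₗ[ℂ] Op A, IsChannel Φ →
    traceOutFst C D ∘ₗ unitaryChannel U ∘ₗ tensorSuper Φ (LinearMap.id : Op B →ₗ[ℂ] Op B) =
      traceOutFst C D ∘ₗ unitaryChannel U

/-- For product input states, the reduced output state on `D` is independent of the state on `A`. -/
def U3 (U : A ⊗[ℂ] B ≃ₗᵢ[ℂ] C ⊗[ℂ] D) : Prop :=
  ∀ (ρ ρ' : Op A) (σ : Op B), IsState ρ → IsState ρ' → IsState σ →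
    traceOutFst C D (unitaryChannel U (TensorProduct.map ρ σ)) =
      traceOutFst C D (unitaryChannel U (TensorProduct.map ρ' σ))

/-- `U` is a circuit of two unitaries `V : B → X ⊗ D` and `W : A ⊗ X → C`, joined by a wire `X`:
`U = (W ⊗ I_D) (I_A ⊗ V)`. The associator `(A ⊗ X) ⊗ D ≃ A ⊗ (X ⊗ D)` is the standard one. (Every
finite-dimensional Hilbert space is isometric to one in the lowest universe, so letting `X` range
over that universe is no restriction.) -/
def U4 (U : A ⊗[ℂ] B ≃ₗᵢ[ℂ] C ⊗[ℂ] D) : Prop :=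
  ∃ (X : Type) (_ : NormedAddCommGroup X) (_ : InnerProductSpace ℂ X) (_ : FiniteDimensional ℂ X)
    (V : B ≃ₗᵢ[ℂ] X ⊗[ℂ] D) (W : A ⊗[ℂ] X ≃ₗᵢ[ℂ] C),
    U = ((TensorProduct.congrIsometry (LinearIsometryEquiv.refl ℂ A) V).trans
      (TensorProduct.assocIsometry ℂ A X D).symm).trans
        (TensorProduct.congrIsometry W (LinearIsometryEquiv.refl ℂ D))

/-- Every local unitary `V` on `A` is carried by `U` to a local unitary `V'` on `C`:
`U (V ⊗ I_B) U† = V' ⊗ I_D`. -/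
def U5 (U : A ⊗[ℂ] B ≃ₗᵢ[ℂ] C ⊗[ℂ] D) : Prop :=
  ∀ V : A ≃ₗᵢ[ℂ] A, ∃ V' : C ≃ₗᵢ[ℂ] C,
    unitaryChannel U (TensorProduct.map V.toLinearMap LinearMap.id) =
      TensorProduct.map V'.toLinearMap LinearMap.id

/-- `[U (𝓛(A) ⊗ I_B) U†, I_C ⊗ 𝓛(D)] = 0`. -/
def U6 (U : A ⊗[ℂ] B ≃ₗᵢ[ℂ] C ⊗[ℂ] D) : Prop :=
  ∀ (X : Op A) (Y : Op D),
    ⁅unitaryChannel U (TensorProduct.map X LinearMap.id),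
      (TensorProduct.map LinearMap.id Y : Module.End ℂ (C ⊗[ℂ] D))⁆ = 0

end Conditions

end

end NoInfluence

/-!
Conditions (U1), (U2), (U3), (U5) all say that the `A`-side of the input cannot influence `D`, and
each of them is equivalent to the commutation relation (U6), from which the circuit (U4) is read off.

The equivalences with (U6) rest on three facts: states and unitaries span the operators
(`op_ext_of_isState`, `op_ext_of_unitary`), the partial trace `Tr_C` is dual to `Y ↦ I ⊗ Y`
(`trace_traceOutFst_comp`), and the trace form is nondegenerate (`eq_of_trace_comp_eq`). Hence
independence of the state on `A` upgrades to invariance under all channels on `A`, and invariance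
under conjugation by unitaries `V` on `A` says that each `U† (I ⊗ Y) U` commutes with `V ⊗ I`.

For the circuit, an operator commuting with all `X ⊗ I` is of the form `I ⊗ S`
(`exists_eq_map_id_left`), so (U6) gives `U† (I ⊗ Y) U = I ⊗ φ Y` for a unital `*`-representation `φ`
of `𝓛(D)` on `B` (`exists_starRep`). Such a representation is a multiple of the standard one: the
images of the matrix units provide a unitary `V : B → X ⊗ D` taking `φ Y` to `I ⊗ Y`
(`exists_unitary_of_starRep`). Then `U (I ⊗ V)†` commutes with `I ⊗ 𝓛(D)` and is therefore
`W ⊗ I` (`exists_unitary_eq_congrIsometry`). Conversely, in a circuit the output on `D` is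
`Tr_X ∘ 𝓥` of the input on `B`, which is a channel by its Kraus form, and a local unitary `T` on `A`
is carried to `W (T ⊗ I) W†`.
-/

open scoped TensorProduct InnerProductSpace ComplexOrder
open TensorProduct (map)

namespace NoInfluence

noncomputable section

variable {A B C D : Type*}
  [NormedAddCommGroup A] [InnerProductSpace ℂ A] [NormedAddCommGroup B] [InnerProductSpace ℂ B]
  [NormedAddCommGroup C] [InnerProductSpace ℂ C] [NormedAddCommGroup D] [InnerProductSpace ℂ D]

/-! ### Operators commuting with one tensor factor -/

theorem exists_norm_one [Nontrivial A] : ∃ a : A, ‖a‖ = 1 := by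
  obtain ⟨x, hx⟩ := exists_ne (0 : A)
  exact ⟨_, norm_smul_inv_norm (𝕜 := ℂ) hx⟩

/-- The rank-one operator `|x⟩⟨y|`. -/
def ketBra (x : B) (y : A) : A →ₗ[ℂ] B := (innerₛₗ ℂ y).smulRight x

@[simp] theorem ketBra_apply (x : B) (y z : A) : ketBra x y z = ⟪y, z⟫_ℂ • x := rfl

theorem map_id_right_injective [Nontrivial D] {S T : A →ₗ[ℂ] B}
    (h : map S (LinearMap.id : Op D) = map T LinearMap.id) : S = T := by
  obtain ⟨d, hd⟩ := exists_norm_one (A := D)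
  ext x
  have := congr(TensorProduct.rid ℂ B (map LinearMap.id (innerₛₗ ℂ d)
    ($h (x ⊗ₜ[ℂ] d))))
  simpa [inner_self_eq_norm_sq_to_K, hd] using this

theorem map_id_left_injective [Nontrivial D] {S T : A →ₗ[ℂ] B}
    (h : map (LinearMap.id : Op D) S = map LinearMap.id T) : S = T := by
  obtain ⟨d, hd⟩ := exists_norm_one (A := D)
  ext x
  have := congr(TensorProduct.lid ℂ B (map (innerₛₗ ℂ d) LinearMap.id
    ($h (d ⊗ₜ[ℂ] x))))
  simpa [inner_self_eq_norm_sq_to_K, hd] using this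

/-- With a unit vector `d₀`, the factor is `S p = (I ⊗ ⟨d₀|) T (p ⊗ d₀)`: commutation with
`I ⊗ |d⟩⟨d₀|` gives `T (p ⊗ d) = (I ⊗ |d⟩⟨d₀|) T (p ⊗ d₀) = S p ⊗ d`. -/
theorem exists_eq_map_id_right [Nontrivial D] (T : A ⊗[ℂ] D →ₗ[ℂ] B ⊗[ℂ] D)
    (h : ∀ Y : Op D, T ∘ₗ map LinearMap.id Y = map LinearMap.id Y ∘ₗ T) :
    ∃ S : A →ₗ[ℂ] B, T = map S LinearMap.id := by
  obtain ⟨d₀, hd⟩ := exists_norm_one (A := D)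
  refine ⟨(TensorProduct.rid ℂ B).toLinearMap ∘ₗ map LinearMap.id (innerₛₗ ℂ d₀) ∘ₗ T ∘ₗ
    (TensorProduct.mk ℂ A D).flip d₀, TensorProduct.ext' fun p d => ?_⟩
  have aux : ∀ z : B ⊗[ℂ] D, map LinearMap.id (ketBra d d₀) z =
      TensorProduct.rid ℂ B (map LinearMap.id (innerₛₗ ℂ d₀) z) ⊗ₜ[ℂ] d := by
    intro z
    induction z with
    | zero => simp
    | tmul q e => simp [TensorProduct.smul_tmul]
    | add x y hx hy => simp only [map_add, hx, hy, TensorProduct.add_tmul]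
  have := LinearMap.congr_fun (h (ketBra d d₀)) (p ⊗ₜ d₀)
  simp only [LinearMap.comp_apply, TensorProduct.map_tmul, aux] at this
  simpa [inner_self_eq_norm_sq_to_K, hd] using this

theorem exists_eq_map_id_left [Nontrivial D] (T : D ⊗[ℂ] A →ₗ[ℂ] D ⊗[ℂ] B)
    (h : ∀ Y : Op D, T ∘ₗ map Y LinearMap.id = map Y LinearMap.id ∘ₗ T) :
    ∃ S : A →ₗ[ℂ] B, T = map LinearMap.id S := by
  obtain ⟨S, hS⟩ := exists_eq_map_id_right
    ((TensorProduct.comm ℂ D B).toLinearMap ∘ₗ T ∘ₗ (TensorProduct.comm ℂ A D).toLinearMap) (by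
      intro Y
      have h1 : (TensorProduct.comm ℂ A D).toLinearMap ∘ₗ map LinearMap.id Y =
          map Y LinearMap.id ∘ₗ (TensorProduct.comm ℂ A D).toLinearMap := by ext; simp
      have h2 : (TensorProduct.comm ℂ D B).toLinearMap ∘ₗ map Y LinearMap.id =
          map LinearMap.id Y ∘ₗ (TensorProduct.comm ℂ D B).toLinearMap := by ext; simp
      rw [LinearMap.comp_assoc, LinearMap.comp_assoc, h1, ← LinearMap.comp_assoc _ _ T, h Y,
        LinearMap.comp_assoc, ← LinearMap.comp_assoc, h2, LinearMap.comp_assoc])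
  refine ⟨S, TensorProduct.ext' fun d p => ?_⟩
  have := LinearMap.congr_fun hS (p ⊗ₜ d)
  simp only [LinearMap.comp_apply, LinearEquiv.coe_coe, TensorProduct.comm_tmul,
    TensorProduct.map_tmul] at this
  rw [← LinearEquiv.eq_symm_apply] at this
  simpa using this

/-! ### Conjugation by unitaries -/

theorem unitaryChannel_apply_apply (U : A ≃ₗᵢ[ℂ] B) (X : Op A) (b : B) :
    unitaryChannel U X b = U (X (U.symm b)) := rfl

theorem unitaryChannel_comp (U : A ≃ₗᵢ[ℂ] B) (X Y : Op A) :
    unitaryChannel U (X ∘ₗ Y) = unitaryChannel U X ∘ₗ unitaryChannel U Y := by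
  ext b; simp [unitaryChannel_apply_apply]

@[simp] theorem unitaryChannel_id (U : A ≃ₗᵢ[ℂ] B) :
    unitaryChannel U LinearMap.id = LinearMap.id := by
  ext b; simp [unitaryChannel_apply_apply]

@[simp] theorem unitaryChannel_symm_apply (U : A ≃ₗᵢ[ℂ] B) (X : Op A) :
    unitaryChannel U.symm (unitaryChannel U X) = X := by
  ext b; simp [unitaryChannel_apply_apply]

@[simp] theorem unitaryChannel_apply_symm (U : A ≃ₗᵢ[ℂ] B) (X : Op B) :
    unitaryChannel U (unitaryChannel U.symm X) = X := by
  ext b; simp [unitaryChannel_apply_apply]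

theorem unitaryChannel_trans (U : A ≃ₗᵢ[ℂ] B) (V : B ≃ₗᵢ[ℂ] C) (X : Op A) :
    unitaryChannel (U.trans V) X = unitaryChannel V (unitaryChannel U X) := rfl

@[simp] theorem trace_unitaryChannel (U : A ≃ₗᵢ[ℂ] B) (X : Op A) :
    LinearMap.trace ℂ B (unitaryChannel U X) = LinearMap.trace ℂ A X :=
  LinearMap.trace_conj' X U.toLinearEquiv

@[simp] theorem unitaryChannel_congrIsometry_map (U : A ≃ₗᵢ[ℂ] C) (V : B ≃ₗᵢ[ℂ] D) (X : Op A)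
    (Y : Op B) : unitaryChannel (TensorProduct.congrIsometry U V) (map X Y) =
      map (unitaryChannel U X) (unitaryChannel V Y) :=
  TensorProduct.ext' fun _ _ => rfl

@[simp] theorem unitaryChannel_refl (X : Op A) :
    unitaryChannel (LinearIsometryEquiv.refl ℂ A) X = X := rfl

theorem trace_unitaryChannel_comp (U : A ≃ₗᵢ[ℂ] B) (X : Op A) (Y : Op B) :
    LinearMap.trace ℂ B (unitaryChannel U X ∘ₗ Y) =
      LinearMap.trace ℂ A (X ∘ₗ unitaryChannel U.symm Y) := by
  rw [← trace_unitaryChannel U, unitaryChannel_comp, unitaryChannel_apply_symm]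

/-- A unitary that fixes every `I ⊗ Y` under conjugation acts on the first factor only. -/
theorem exists_unitary_eq_congrIsometry [Nontrivial D] (M : A ⊗[ℂ] D ≃ₗᵢ[ℂ] B ⊗[ℂ] D)
    (h : ∀ Y : Op D, unitaryChannel M (map LinearMap.id Y) = map LinearMap.id Y) :
    ∃ W : A ≃ₗᵢ[ℂ] B, M = TensorProduct.congrIsometry W (LinearIsometryEquiv.refl ℂ D) := by
  obtain ⟨d, hd⟩ := exists_norm_one (A := D)
  obtain ⟨S, hS⟩ := exists_eq_map_id_right M.toLinearMap fun Y => by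
    conv_rhs => rw [← h Y]
    exact LinearMap.ext fun z => by simp [unitaryChannel_apply_apply]
  obtain ⟨T, hT⟩ := exists_eq_map_id_right M.symm.toLinearMap fun Y => by
    conv_lhs => rw [← h Y]
    exact LinearMap.ext fun z => by simp [unitaryChannel_apply_apply]
  have hST : S ∘ₗ T = LinearMap.id := map_id_right_injective (D := D) <| by
    rw [← LinearMap.id_comp (LinearMap.id : Op D), TensorProduct.map_comp, ← hS, ← hT]
    exact LinearMap.ext fun z => by simp
  have hTS : T ∘ₗ S = LinearMap.id := map_id_right_injective (D := D) <| by
    rw [← LinearMap.id_comp (LinearMap.id : Op D), TensorProduct.map_comp, ← hS, ← hT]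
    exact LinearMap.ext fun z => by simp
  have hM (a d) : M (a ⊗ₜ d) = S a ⊗ₜ d := LinearMap.congr_fun hS (a ⊗ₜ d)
  refine ⟨(LinearEquiv.ofLinearMap S T hST hTS).isometryOfInner fun x y => ?_, ?_⟩
  · have := M.inner_map_map (x ⊗ₜ d) (y ⊗ₜ d)
    simpa [hM, inner_self_eq_norm_sq_to_K, hd] using this
  · ext z
    exact LinearMap.congr_fun hS z

/-! ### Conditions (U4), (U5) and (U6) as identities of operators -/

theorem U6_iff {U : A ⊗[ℂ] B ≃ₗᵢ[ℂ] C ⊗[ℂ] D} :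
    U6 U ↔ ∀ (X : Op A) (Y : Op D),
      unitaryChannel U (map X LinearMap.id) ∘ₗ map LinearMap.id Y =
        map LinearMap.id Y ∘ₗ unitaryChannel U (map X LinearMap.id) := by
  refine forall₂_congr fun X Y => ?_
  rw [LieRing.of_associative_ring_bracket, sub_eq_zero]
  rfl

/-- The local unitary on `C` is `V' = W (T ⊗ I_X) W†`. -/
theorem U5_of_U4 {U : A ⊗[ℂ] B ≃ₗᵢ[ℂ] C ⊗[ℂ] D} (h : U4 U) : U5 U := by
  obtain ⟨X, _, _, _, V, W, rfl⟩ := h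
  intro T
  refine ⟨(W.symm.trans (TensorProduct.congrIsometry T (LinearIsometryEquiv.refl ℂ X))).trans W, ?_⟩
  have h1 : unitaryChannel (TensorProduct.assocIsometry ℂ A X D).symm
      (map T.toLinearMap LinearMap.id) =
      map (map T.toLinearMap LinearMap.id) LinearMap.id :=
    TensorProduct.ext_threefold fun a x d => by simp [unitaryChannel_apply_apply]
  rw [unitaryChannel_trans, unitaryChannel_trans, unitaryChannel_congrIsometry_map,
    unitaryChannel_id, unitaryChannel_refl, h1, unitaryChannel_congrIsometry_map,
    unitaryChannel_id]
  rfl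

variable [FiniteDimensional ℂ A]

/-! ### Spanning sets of operators -/

theorem op_ext_of_unitary {M : Type*} [AddCommGroup M] [Module ℂ M] {f g : Op A →ₗ[ℂ] M}
    (h : ∀ V : A ≃ₗᵢ[ℂ] A, f V.toLinearMap = g V.toLinearMap) : f = g := by
  let c : (A →L[ℂ] A) →ₗ[ℂ] Op A := LinearMap.toContinuousLinearMap.symm.toLinearMap
  have : f ∘ₗ c = g ∘ₗ c := LinearMap.ext_on (CStarAlgebra.span_unitary (A →L[ℂ] A))
    fun u hu => h (Unitary.linearIsometryEquiv ⟨u, hu⟩)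
  ext1 T
  exact LinearMap.congr_fun this (LinearMap.toContinuousLinearMap T)

theorem op_ext_of_isPositive {M : Type*} [AddCommGroup M] [Module ℂ M] {f g : Op A →ₗ[ℂ] M}
    (h : ∀ P : Op A, P.IsPositive → f P = g P) : f = g := by
  let c : (A →L[ℂ] A) →ₗ[ℂ] Op A := LinearMap.toContinuousLinearMap.symm.toLinearMap
  have : f ∘ₗ c = g ∘ₗ c := LinearMap.ext_on (CStarAlgebra.span_nonneg (A := A →L[ℂ] A))
    fun P hP => h _ ((ContinuousLinearMap.nonneg_iff_isPositive P).1 hP)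
  ext1 T
  exact LinearMap.congr_fun this (LinearMap.toContinuousLinearMap T)

/-- Positive operators span; `P = (P + I) - I` writes each of them through positive operators of
nonzero trace, which are multiples of states. -/
theorem op_ext_of_isState [Nontrivial A] {M : Type*} [AddCommGroup M] [Module ℂ M]
    {f g : Op A →ₗ[ℂ] M} (h : ∀ ρ : Op A, IsState ρ → f ρ = g ρ) : f = g := by
  have pos (P : Op A) (hP : P.IsPositive) (ht : LinearMap.trace ℂ A P ≠ 0) : f P = g P := by
    have := h ((LinearMap.trace ℂ A P)⁻¹ • P)
      ⟨hP.smul_of_nonneg (inv_nonneg.2 hP.trace_nonneg), by simp [ht]⟩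
    simpa [ht] using this
  have dim : (0 : ℂ) < LinearMap.trace ℂ A LinearMap.id := by
    rw [LinearMap.trace_id]; exact_mod_cast Module.finrank_pos
  refine op_ext_of_isPositive fun P hP => ?_
  have h1 := pos _ LinearMap.isPositive_id dim.ne'
  have h2 := pos (P + LinearMap.id) (hP.add LinearMap.isPositive_id) (by
    rw [map_add]; exact (add_pos_of_nonneg_of_pos hP.trace_nonneg dim).ne')
  simpa [h1] using h2

theorem exists_isState (A : Type*) [NormedAddCommGroup A] [InnerProductSpace ℂ A]
    [FiniteDimensional ℂ A] [Nontrivial A] : ∃ ρ : Op A, IsState ρ := by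
  by_contra! h
  have := op_ext_of_isState (A := A) (f := LinearMap.id) (g := 0) fun ρ hρ => (h ρ hρ).elim
  exact one_ne_zero (LinearMap.congr_fun this (1 : Op A))

/-- The trace form is nondegenerate: testing against `|x⟩⟨y|` reads off `⟪y, S x⟫`. -/
theorem eq_of_trace_comp_eq {S S' : Op A}
    (h : ∀ T : Op A, LinearMap.trace ℂ A (T ∘ₗ S) = LinearMap.trace ℂ A (T ∘ₗ S')) : S = S' := by
  ext x
  refine ext_inner_left ℂ fun y => ?_
  have key (R : Op A) : LinearMap.trace ℂ A (ketBra x y ∘ₗ R) = ⟪y, R x⟫_ℂ := by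
    rw [LinearMap.trace_comp_comm',
      show R ∘ₗ ketBra x y = (innerₛₗ ℂ y).smulRight (R x) by ext; simp, LinearMap.trace_smulRight]
    rfl
  rw [← key, ← key, h]

/-- Commutation with `I ⊗ Y` is linear in `X`, and unitaries span `𝓛(A)`. -/
theorem U6_of_commute_unitary {U : A ⊗[ℂ] B ≃ₗᵢ[ℂ] C ⊗[ℂ] D}
    (h : ∀ (V : A ≃ₗᵢ[ℂ] A) (Y : Op D),
      unitaryChannel U (map V.toLinearMap LinearMap.id) ∘ₗ map LinearMap.id Y =
        map LinearMap.id Y ∘ₗ unitaryChannel U (map V.toLinearMap LinearMap.id)) : U6 U := by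
  rw [U6_iff]
  intro X Y
  let F : Op A →ₗ[ℂ] Op (C ⊗[ℂ] D) :=
    unitaryChannel U ∘ₗ (TensorProduct.mapBilinear (.id ℂ) A B A B).flip LinearMap.id
  have : LinearMap.lcomp ℂ _ (map LinearMap.id Y) ∘ₗ F =
      LinearMap.llcomp ℂ _ _ _ (map LinearMap.id Y) ∘ₗ F :=
    op_ext_of_unitary fun V => h V Y
  exact LinearMap.congr_fun this X

theorem U6_of_U5 {U : A ⊗[ℂ] B ≃ₗᵢ[ℂ] C ⊗[ℂ] D} (h : U5 U) : U6 U := by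
  refine U6_of_commute_unitary fun V Y => ?_
  obtain ⟨V', hV'⟩ := h V
  rw [hV', ← TensorProduct.map_comp, ← TensorProduct.map_comp]
  simp

variable [FiniteDimensional ℂ B]

/-! ### Channels and the partial trace -/

/-- Linear maps out of `𝓛(A ⊗ B, C ⊗ D)` are determined by their values on products `X ⊗ Y`. -/
theorem op_tensor_ext {M : Type*} [AddCommGroup M] [Module ℂ M]
    {f g : (A ⊗[ℂ] B →ₗ[ℂ] C ⊗[ℂ] D) →ₗ[ℂ] M}
    (h : ∀ (X : A →ₗ[ℂ] C) (Y : B →ₗ[ℂ] D), f (map X Y) = g (map X Y)) : f = g := by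
  have key : f ∘ₗ (homTensorHomEquiv ℂ A B C D).toLinearMap =
      g ∘ₗ (homTensorHomEquiv ℂ A B C D).toLinearMap :=
    TensorProduct.ext' fun X Y => by simpa using h X Y
  ext T
  simpa only [LinearMap.comp_apply, LinearEquiv.coe_coe, LinearEquiv.apply_symm_apply] using
    LinearMap.congr_fun key ((homTensorHomEquiv ℂ A B C D).symm T)

variable [FiniteDimensional ℂ C] [FiniteDimensional ℂ D]

theorem unitaryChannel_adjoint (U : A ≃ₗᵢ[ℂ] B) (X : Op A) :
    unitaryChannel U (LinearMap.adjoint X) = LinearMap.adjoint (unitaryChannel U X) := by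
  rw [unitaryChannel_apply, unitaryChannel_apply, LinearMap.adjoint_comp, LinearMap.adjoint_comp,
    LinearMap.adjoint_adjoint, LinearMap.comp_assoc]

theorem tensorSuper_unitaryChannel_id (V : A ≃ₗᵢ[ℂ] A) :
    tensorSuper (unitaryChannel V) (LinearMap.id : Op B →ₗ[ℂ] Op B) =
      unitaryChannel (TensorProduct.congrIsometry V (LinearIsometryEquiv.refl ℂ B)) :=
  op_tensor_ext fun X Y => by simp [tensorSuper_map]

/-- A map in Kraus form is completely positive, since `I ⊗ Φ` then has the Kraus operators
`I ⊗ K i`. -/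
theorem isCompletelyPositive_of_kraus {ι : Type*} [Fintype ι] (K : ι → A →ₗ[ℂ] B)
    {Φ : Op A →ₗ[ℂ] Op B} (h : ∀ X, Φ X = ∑ i, K i ∘ₗ X ∘ₗ LinearMap.adjoint (K i)) :
    IsCompletelyPositive Φ := by
  intro n P hP
  let L (i : ι) : EuclideanSpace ℂ (Fin n) ⊗[ℂ] A →ₗ[ℂ] EuclideanSpace ℂ (Fin n) ⊗[ℂ] B :=
    map LinearMap.id (K i)
  let F : Op (EuclideanSpace ℂ (Fin n) ⊗[ℂ] A) →ₗ[ℂ] Op (EuclideanSpace ℂ (Fin n) ⊗[ℂ] B) :=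
    ∑ i, (LinearMap.llcomp ℂ _ _ _ (L i)) ∘ₗ LinearMap.lcomp ℂ _ (LinearMap.adjoint (L i))
  have hF (T) : F T = ∑ i, L i ∘ₗ T ∘ₗ LinearMap.adjoint (L i) := by
    simp [F]; rfl
  have : tensorSuper LinearMap.id Φ = F := op_tensor_ext fun X Y => by
    simp only [tensorSuper_map, h, hF, L, TensorProduct.adjoint_map, LinearMap.adjoint_id,
      ← TensorProduct.map_comp, LinearMap.id_comp, LinearMap.comp_id, LinearMap.id_apply]
    exact map_sum (TensorProduct.mapBilinear (.id ℂ) _ _ _ _ X) _ _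
  rw [this, hF]
  exact LinearMap.isPositive_sum _ fun i _ => hP.conj_adjoint _

theorem isChannel_unitaryChannel (U : A ≃ₗᵢ[ℂ] B) : IsChannel (unitaryChannel U) :=
  ⟨isCompletelyPositive_of_kraus (fun _ : Unit => U.toLinearMap) fun X => by
    simp [unitaryChannel_apply], trace_unitaryChannel U⟩

/-- The partial trace in Kraus form, `Tr_A T = ∑ᵢ (⟨eᵢ| ⊗ I) T (|eᵢ⟩ ⊗ I)`; here `|eᵢ⟩ ⊗ I` is
`b ↦ eᵢ ⊗ b`. -/
theorem traceOutFst_eq_sum {ι : Type*} [Fintype ι] (e : OrthonormalBasis ι ℂ A)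
    (T : Op (A ⊗[ℂ] B)) :
    traceOutFst A B T = ∑ i, LinearMap.adjoint (TensorProduct.mk ℂ A B (e i)) ∘ₗ T ∘ₗ
      TensorProduct.mk ℂ A B (e i) := by
  let F : Op (A ⊗[ℂ] B) →ₗ[ℂ] Op B :=
    ∑ i, (LinearMap.llcomp ℂ _ _ _ (LinearMap.adjoint (TensorProduct.mk ℂ A B (e i)))) ∘ₗ
      LinearMap.lcomp ℂ _ (TensorProduct.mk ℂ A B (e i))
  have hF (T) : F T = ∑ i, LinearMap.adjoint (TensorProduct.mk ℂ A B (e i)) ∘ₗ T ∘ₗ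
      TensorProduct.mk ℂ A B (e i) := by
    simp [F]; rfl
  have : traceOutFst A B = F := op_tensor_ext fun X Y => by
    rw [hF, traceOutFst_map, LinearMap.trace_eq_sum_inner X e]
    ext b
    refine ext_inner_left ℂ fun b' => ?_
    simp [LinearMap.sum_apply, inner_sum, LinearMap.adjoint_inner_right, inner_smul_right,
      Finset.sum_mul]
  rw [this, hF]

/-- The partial trace is dual to `Y ↦ I ⊗ Y` for the trace form. -/
theorem trace_traceOutFst_comp (T : Op (A ⊗[ℂ] B)) (Y : Op B) :
    LinearMap.trace ℂ B (traceOutFst A B T ∘ₗ Y) =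
      LinearMap.trace ℂ (A ⊗[ℂ] B) (T ∘ₗ map LinearMap.id Y) := by
  suffices h : LinearMap.trace ℂ B ∘ₗ LinearMap.lcomp ℂ B Y ∘ₗ traceOutFst A B =
      LinearMap.trace ℂ (A ⊗[ℂ] B) ∘ₗ LinearMap.lcomp ℂ _ (map LinearMap.id Y) from
    LinearMap.congr_fun h T
  refine op_tensor_ext fun X Z => ?_
  simp only [LinearMap.comp_apply, LinearMap.lcomp_apply', traceOutFst_map,
    ← TensorProduct.map_comp, LinearMap.comp_id, LinearMap.trace_tensorProduct', map_smul,
    smul_eq_mul]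

@[simp] theorem trace_traceOutFst (T : Op (A ⊗[ℂ] B)) :
    LinearMap.trace ℂ B (traceOutFst A B T) = LinearMap.trace ℂ (A ⊗[ℂ] B) T := by
  simpa using trace_traceOutFst_comp T LinearMap.id

/-! ### Independence of the state on `A` -/

theorem U3_of_U1 {U : A ⊗[ℂ] B ≃ₗᵢ[ℂ] C ⊗[ℂ] D} (h : U1 U) : U3 U := by
  obtain ⟨Ψ, -, hΨ⟩ := h
  rintro ρ ρ' σ hρ hρ' -
  have key (τ : Op A) (hτ : IsState τ) :
      traceOutFst C D (unitaryChannel U (map τ σ)) = Ψ σ := by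
    simpa [traceOutFst_map, hτ.2] using LinearMap.congr_fun hΨ (map τ σ)
  rw [key ρ hρ, key ρ' hρ']

/-- States span `𝓛(A)` and `𝓛(B)`, so (U3) extends to
`Tr_C 𝓤(X ⊗ Y) = tr X • Tr_C 𝓤(ρ₀ ⊗ Y)` for all operators, and the right-hand side only sees the
trace of `X`. -/
theorem U2_of_U3 [Nontrivial A] [Nontrivial B] {U : A ⊗[ℂ] B ≃ₗᵢ[ℂ] C ⊗[ℂ] D} (h : U3 U) :
    U2 U := by
  obtain ⟨ρ₀, hρ₀⟩ := exists_isState A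
  set g := traceOutFst C D ∘ₗ unitaryChannel U with hg
  have key (X : Op A) (Y : Op B) :
      g (map X Y) = LinearMap.trace ℂ A X • g (map ρ₀ Y) := by
    have h1 (ρ : Op A) (hρ : IsState ρ) : g ∘ₗ TensorProduct.mapBilinear (.id ℂ) A B A B ρ =
        g ∘ₗ TensorProduct.mapBilinear (.id ℂ) A B A B ρ₀ :=
      op_ext_of_isState fun σ hσ => h ρ ρ₀ σ hρ hρ₀ hσ
    have h2 : g ∘ₗ (TensorProduct.mapBilinear (.id ℂ) A B A B).flip Y =
        (LinearMap.trace ℂ A).smulRight (g (map ρ₀ Y)) :=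
      op_ext_of_isState fun ρ hρ => by
        simpa [hρ.2] using LinearMap.congr_fun (h1 ρ hρ) Y
    simpa using LinearMap.congr_fun h2 X
  intro Φ hΦ
  rw [← LinearMap.comp_assoc, ← hg]
  refine op_tensor_ext fun X Y => ?_
  rw [LinearMap.comp_apply, tensorSuper_map, key, key X, hΦ.2, LinearMap.id_apply]

/-- Taking `Φ` to be conjugation by a unitary `V` and dualizing, `U† (I ⊗ Y) U` is invariant under
conjugation by `V ⊗ I`, that is, commutes with it. -/
theorem U6_of_U2 {U : A ⊗[ℂ] B ≃ₗᵢ[ℂ] C ⊗[ℂ] D} (h : U2 U) : U6 U := by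
  refine U6_of_commute_unitary fun V Y => ?_
  let W := TensorProduct.congrIsometry V (LinearIsometryEquiv.refl ℂ B)
  let S := unitaryChannel U.symm (map LinearMap.id Y)
  have inv : unitaryChannel W.symm S = S := eq_of_trace_comp_eq fun T => by
    have := LinearMap.congr_fun (h _ (isChannel_unitaryChannel V)) T
    rw [tensorSuper_unitaryChannel_id] at this
    have := congr(LinearMap.trace ℂ D ($this ∘ₗ Y))
    simpa only [LinearMap.comp_apply, trace_traceOutFst_comp, trace_unitaryChannel_comp] using this
  have hW : map V.toLinearMap LinearMap.id = W.toLinearMap := rfl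
  have comm : W.toLinearMap ∘ₗ S = S ∘ₗ W.toLinearMap := by
    conv_rhs => rw [← unitaryChannel_apply_symm W S, inv]
    exact LinearMap.ext fun z => by simp [unitaryChannel_apply_apply]
  have := congr(unitaryChannel U $comm)
  rw [unitaryChannel_comp, unitaryChannel_comp] at this
  simpa only [S, unitaryChannel_apply_symm, hW] using this

/-! ### Circuits -/

/-- A unital `*`-representation of `𝓛(D)` on `B` splits off a factor `D`. With a unit vector `d₀`,
the other factor is the range of `φ(|d₀⟩⟨d₀|)`, and `x ⊗ d` corresponds to `φ(|d⟩⟨d₀|) x`. -/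
theorem exists_unitary_of_starRep [Nontrivial D] (φ : Op D →ₗ[ℂ] Op B)
    (one : φ LinearMap.id = LinearMap.id) (mul : ∀ Y Z, φ (Y ∘ₗ Z) = φ Y ∘ₗ φ Z)
    (adj : ∀ Y, φ (LinearMap.adjoint Y) = LinearMap.adjoint (φ Y)) :
    ∃ (n : ℕ) (V : B ≃ₗᵢ[ℂ] EuclideanSpace ℂ (Fin n) ⊗[ℂ] D),
      ∀ Y, unitaryChannel V (φ Y) = map LinearMap.id Y := by
  obtain ⟨d₀, hd⟩ := exists_norm_one (A := D)
  have ketBra_comp (x y : D) (u v : D) :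
      ketBra x y ∘ₗ ketBra u v = ⟪y, u⟫_ℂ • ketBra x v := by
    ext z; simp [smul_smul, mul_comm]
  have ketBra_adj (x y : D) : LinearMap.adjoint (ketBra x y) = ketBra y x := by
    symm
    rw [LinearMap.eq_adjoint_iff]
    intro u v
    simp [inner_smul_left, inner_smul_right, mul_comm]
  have hd' : ⟪d₀, d₀⟫_ℂ = 1 := by simp [inner_self_eq_norm_sq_to_K, hd]
  let R := LinearMap.range (φ (ketBra d₀ d₀))
  let j : EuclideanSpace ℂ (Fin (Module.finrank ℂ R)) →ₗᵢ[ℂ] B :=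
    R.subtypeₗᵢ.comp (stdOrthonormalBasis ℂ R).repr.symm.toLinearIsometry
  -- `φ |d₀⟩⟨d₀|` is idempotent, so it fixes its range.
  have hj (x) : φ (ketBra d₀ d₀) (j x) = j x := by
    obtain ⟨b, hb⟩ := ((stdOrthonormalBasis ℂ R).repr.symm x).2
    have : j x = φ (ketBra d₀ d₀) b := hb.symm
    rw [this, ← LinearMap.comp_apply, ← mul, ketBra_comp, hd', one_smul]
  have hj' (b : B) : ∃ x, j x = φ (ketBra d₀ d₀) b :=
    ⟨(stdOrthonormalBasis ℂ R).repr ⟨_, LinearMap.mem_range_self _ b⟩, by simp [j]⟩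
  -- `d ↦ |d⟩⟨d₀|` as a linear map.
  let kb : D →ₗ[ℂ] Op D := LinearMap.smulRightₗ (innerₛₗ ℂ d₀)
  let g : EuclideanSpace ℂ (Fin (Module.finrank ℂ R)) ⊗[ℂ] D →ₗ[ℂ] B :=
    TensorProduct.lift ((φ ∘ₗ kb).flip ∘ₗ j.toLinearMap)
  have hg (x d) : g (x ⊗ₜ d) = φ (ketBra d d₀) (j x) := rfl
  have hgY (Y : Op D) : g ∘ₗ map LinearMap.id Y = φ Y ∘ₗ g := TensorProduct.ext' fun x d => by
    have : ketBra (Y d) d₀ = Y ∘ₗ ketBra d d₀ := by ext; simp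
    simp [hg, this, mul]
  have hin (z w) : ⟪g z, g w⟫_ℂ = ⟪z, w⟫_ℂ := by
    induction z with
    | zero => simp
    | add x y hx hy => simp only [map_add, inner_add_left, hx, hy]
    | tmul x d =>
      induction w with
      | zero => simp
      | add x y hx hy => simp only [map_add, inner_add_right, hx, hy]
      | tmul x' d' =>
        rw [hg, hg, ← LinearMap.adjoint_inner_right, ← adj, ← LinearMap.comp_apply, ← mul,
          ketBra_adj, ketBra_comp, map_smul, LinearMap.smul_apply, hj, inner_smul_right,
          LinearIsometry.inner_map_map, TensorProduct.inner_tmul, mul_comm]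
  have hsurj : Function.Surjective (g.isometryOfInner hin) := by
    -- `b = ∑ᵢ φ |eᵢ⟩⟨eᵢ| b = ∑ᵢ φ |eᵢ⟩⟨d₀| (φ |d₀⟩⟨eᵢ| b)`, and `φ |d₀⟩⟨eᵢ| b` is in the range of
    -- `φ |d₀⟩⟨d₀|`.
    intro b
    let e := stdOrthonormalBasis ℂ D
    choose x hx using fun i => hj' (φ (ketBra d₀ (e i)) b)
    refine ⟨∑ i, x i ⊗ₜ e i, ?_⟩
    have hsum : ∑ i, ketBra (e i) (e i) = LinearMap.id := by
      ext z
      simpa [LinearMap.sum_apply] using e.sum_repr' z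
    have term (i) : φ (ketBra (e i) d₀) (φ (ketBra d₀ d₀) (φ (ketBra d₀ (e i)) b)) =
        φ (ketBra (e i) (e i)) b := by
      simp only [← LinearMap.comp_apply, ← mul, ketBra_comp, hd', one_smul]
    simp only [LinearMap.coe_isometryOfInner, map_sum, hg, hx, term]
    rw [← LinearMap.sum_apply, ← map_sum, hsum, one, LinearMap.id_apply]
  refine ⟨_, (LinearIsometryEquiv.ofSurjective (g.isometryOfInner hin) hsurj).symm, fun Y => ?_⟩
  set G := LinearIsometryEquiv.ofSurjective (g.isometryOfInner hin) hsurj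
  have hG (z) : G z = g z := rfl
  refine LinearMap.ext fun z => ?_
  rw [unitaryChannel_apply_apply, LinearIsometryEquiv.symm_symm, LinearIsometryEquiv.symm_apply_eq,
    hG, hG]
  exact (LinearMap.congr_fun (hgY Y) z).symm

/-- `U† (I ⊗ Y) U` commutes with `𝓛(A) ⊗ I`, hence has the form `I ⊗ φ Y`; since `S ↦ I ⊗ S` is
injective, `φ` inherits the `*`-algebra structure of `Y ↦ U† (I ⊗ Y) U`. -/
theorem exists_starRep [Nontrivial A] {U : A ⊗[ℂ] B ≃ₗᵢ[ℂ] C ⊗[ℂ] D} (h : U6 U) :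
    ∃ φ : Op D →ₗ[ℂ] Op B, φ LinearMap.id = LinearMap.id ∧ (∀ Y Z, φ (Y ∘ₗ Z) = φ Y ∘ₗ φ Z) ∧
      (∀ Y, φ (LinearMap.adjoint Y) = LinearMap.adjoint (φ Y)) ∧
      ∀ Y, unitaryChannel U (map LinearMap.id (φ Y)) = map LinearMap.id Y := by
  rw [U6_iff] at h
  have hex (Y : Op D) : ∃ S : Op B, unitaryChannel U.symm (map LinearMap.id Y) =
      map LinearMap.id S := exists_eq_map_id_left _ fun X => by
    have := congr(unitaryChannel U.symm $(h X Y))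
    simpa [unitaryChannel_comp] using this.symm
  choose φ hφ using hex
  have inj {S T : Op B} (h : map (LinearMap.id : Op A) S = map LinearMap.id T) : S = T :=
    map_id_left_injective h
  refine ⟨{ toFun := φ, map_add' Y Z := inj ?_, map_smul' c Y := inj ?_ }, inj ?_,
    fun Y Z => inj ?_, fun Y => inj ?_, fun Y => ?_⟩
  · rw [TensorProduct.map_add_right, ← hφ, ← hφ, ← hφ, TensorProduct.map_add_right, map_add]
  · rw [RingHom.id_apply, TensorProduct.map_smul_right, ← hφ, ← hφ, TensorProduct.map_smul_right,
      map_smul]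
  · change map _ (φ _) = _
    rw [← hφ, TensorProduct.map_id, TensorProduct.map_id, unitaryChannel_id]
  · change map _ (φ _) = map _ (φ _ ∘ₗ φ _)
    rw [← LinearMap.id_comp (LinearMap.id : Op A), TensorProduct.map_comp, LinearMap.id_comp,
      ← hφ, ← hφ, ← hφ, ← unitaryChannel_comp, ← TensorProduct.map_comp, LinearMap.id_comp]
  · change map _ (φ _) = map _ (LinearMap.adjoint (φ _))
    rw [← LinearMap.adjoint_id (𝕜 := ℂ) (E := A), ← TensorProduct.adjoint_map, LinearMap.adjoint_id,
      ← hφ, ← hφ, ← unitaryChannel_adjoint, TensorProduct.adjoint_map, LinearMap.adjoint_id]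
  · change unitaryChannel U (map _ (φ Y)) = _
    rw [← hφ, unitaryChannel_apply_symm]

/-- With `V` from the representation `φ`, conjugation by the unitary `U (I ⊗ V)†` from
`(A ⊗ X) ⊗ D` to `C ⊗ D` fixes every `I ⊗ Y`, so this unitary is `W ⊗ I`. -/
theorem U4_of_U6 [Nontrivial A] [Nontrivial D] {U : A ⊗[ℂ] B ≃ₗᵢ[ℂ] C ⊗[ℂ] D} (h : U6 U) :
    U4 U := by
  obtain ⟨φ, one, mul, adj, hφ⟩ := exists_starRep h
  obtain ⟨n, V, hV⟩ := exists_unitary_of_starRep φ one mul adj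
  let E := (TensorProduct.congrIsometry (LinearIsometryEquiv.refl ℂ A) V).trans
    (TensorProduct.assocIsometry ℂ A (EuclideanSpace ℂ (Fin n)) D).symm
  have hE (Y : Op D) : unitaryChannel E (map LinearMap.id (φ Y)) = map LinearMap.id Y := by
    rw [unitaryChannel_trans, unitaryChannel_congrIsometry_map, hV, unitaryChannel_refl]
    refine TensorProduct.ext_threefold fun a x d => ?_
    simp [unitaryChannel_apply_apply]
  obtain ⟨W, hW⟩ := exists_unitary_eq_congrIsometry (E.symm.trans U) fun Y => by
    rw [← hE Y, unitaryChannel_trans, unitaryChannel_symm_apply, hφ]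
  refine ⟨EuclideanSpace ℂ (Fin n), inferInstance, inferInstance, inferInstance, V, W, ?_⟩
  rw [← hW]
  exact LinearIsometryEquiv.ext fun z => congrArg U (E.symm_apply_apply z).symm

theorem isChannel_traceOutFst : IsChannel (traceOutFst A B) :=
  ⟨isCompletelyPositive_of_kraus
    (fun i => LinearMap.adjoint (TensorProduct.mk ℂ A B (stdOrthonormalBasis ℂ A i))) fun T => by
      simp only [LinearMap.adjoint_adjoint, traceOutFst_eq_sum (stdOrthonormalBasis ℂ A) T],
    trace_traceOutFst⟩

theorem IsChannel.comp {Φ : Op A →ₗ[ℂ] Op B} {Ψ : Op B →ₗ[ℂ] Op C} (hΨ : IsChannel Ψ)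
    (hΦ : IsChannel Φ) : IsChannel (Ψ ∘ₗ Φ) := by
  refine ⟨fun n P hP => ?_, fun X => by rw [LinearMap.comp_apply, hΨ.2, hΦ.2]⟩
  have : tensorSuper (LinearMap.id : Op (EuclideanSpace ℂ (Fin n)) →ₗ[ℂ] _) (Ψ ∘ₗ Φ) =
      tensorSuper LinearMap.id Ψ ∘ₗ tensorSuper LinearMap.id Φ :=
    op_tensor_ext fun X Y => by simp [tensorSuper_map]
  rw [this]
  exact hΨ.1 n _ (hΦ.1 n P hP)

/-- The channel is `Tr_X ∘ 𝓥`: as `W` is unitary, tracing out `C` after `W` is tracing out `A`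
and `X`. -/
theorem U1_of_U4 {U : A ⊗[ℂ] B ≃ₗᵢ[ℂ] C ⊗[ℂ] D} (h : U4 U) : U1 U := by
  obtain ⟨X, _, _, _, V, W, rfl⟩ := h
  refine ⟨traceOutFst X D ∘ₗ unitaryChannel V,
    isChannel_traceOutFst.comp (isChannel_unitaryChannel V), op_tensor_ext fun P Q => ?_⟩
  let L := traceOutFst C D ∘ₗ
    unitaryChannel (TensorProduct.congrIsometry W (LinearIsometryEquiv.refl ℂ D)) ∘ₗ
      unitaryChannel (TensorProduct.assocIsometry ℂ A X D).symm ∘ₗ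
        TensorProduct.mapBilinear (.id ℂ) A (X ⊗[ℂ] D) A (X ⊗[ℂ] D) P
  have key : L = LinearMap.trace ℂ A P • traceOutFst X D := op_tensor_ext fun Z Y => by
    have h1 : unitaryChannel (TensorProduct.assocIsometry ℂ A X D).symm (map P (map Z Y)) =
        map (map P Z) Y :=
      TensorProduct.ext_threefold fun a x d => by simp [unitaryChannel_apply_apply]
    simp [L, h1, traceOutFst_map, LinearMap.trace_tensorProduct', mul_smul]
  rw [LinearMap.comp_apply, unitaryChannel_trans, unitaryChannel_trans,
    unitaryChannel_congrIsometry_map, unitaryChannel_refl, LinearMap.comp_apply, traceOutFst_map]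
  simpa [L] using LinearMap.congr_fun key (unitaryChannel V Q)

end
end NoInfluence

theorem theorem3p1 {A B C D : Type*}
    [NormedAddCommGroup A] [InnerProductSpace ℂ A] [FiniteDimensional ℂ A] [Nontrivial A]
    [NormedAddCommGroup B] [InnerProductSpace ℂ B] [FiniteDimensional ℂ B] [Nontrivial B]
    [NormedAddCommGroup C] [InnerProductSpace ℂ C] [FiniteDimensional ℂ C]
    [NormedAddCommGroup D] [InnerProductSpace ℂ D] [FiniteDimensional ℂ D]
    (U : A ⊗[ℂ] B ≃ₗᵢ[ℂ] C ⊗[ℂ] D) :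
    List.TFAE [NoInfluence.U1 U, NoInfluence.U2 U, NoInfluence.U3 U,
      NoInfluence.U4 U, NoInfluence.U5 U, NoInfluence.U6 U] := by
  -- A unit vector `a ⊗ b` exists, so `C ⊗ D`, and with it `D`, is nonzero.
  have : Nontrivial D := by
    obtain ⟨a, ha⟩ := NoInfluence.exists_norm_one (A := A)
    obtain ⟨b, hb⟩ := NoInfluence.exists_norm_one (A := B)
    by_contra hD
    rw [not_nontrivial_iff_subsingleton] at hD
    have : ‖U (a ⊗ₜ b)‖ = 1 := by simp [ha, hb]
    rw [Subsingleton.elim (U (a ⊗ₜ b)) 0] at this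
    simp at this
  tfae_have 1 → 3 := NoInfluence.U3_of_U1
  tfae_have 3 → 2 := NoInfluence.U2_of_U3
  tfae_have 2 → 6 := NoInfluence.U6_of_U2
  tfae_have 6 → 4 := NoInfluence.U4_of_U6
  tfae_have 4 → 1 := NoInfluence.U1_of_U4
  tfae_have 4 → 5 := NoInfluence.U5_of_U4
  tfae_have 5 → 6 := NoInfluence.U6_of_U5
  tfae_finish
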